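/- Let $H$ be a real or complex Hilbert space. For a family $W=(W_i,w_i)_{i\in I}$ of closed subspaces $W_i\subseteq H$ with weights $w_i>0$, let $\pi_{W_i}$ be the orthogonal projection onto $W_i$. $W$ is a *Bessel fusion sequence* if there is $B<\infty$ with $\sum_i w_i^2\|\pi_{W_i}f\|^2\le B\|f\|^2$ for all $f\in H$, and a *fusion frame* if moreover $A\|f\|^2\le\sum_i w_i^2\|\pi_{W_i}f\|^2$ for all $f$ with some $A>0$. Its *synthesis operator* is $T_W:(\bigoplus_i W_i)_{\ell^2}\to H$, $T_W(f_i)_i=\sum_i w_if_i$, and its *fusion frame operator* is $S_W=T_WT_W^*$, i.e. $S_Wf=\sum_i w_i^2\pi_{W_i}f$; for a fusion frame, $S_W$ is invertible. The *canonical dual* of a fusion frame $W$ is $\widetilde W=(S_W^{-1}W_i,w_i)_{i\in I}$. A Bessel fusion sequence $W'=(W'_i,w'_i)_{i\in I}$ is an (*alternate*, or Găvruţa) *dual* of $W$ if $f=\sum_i w_iw'_i\,\pi_{W'_i}S_W^{-1}\pi_{W_i}f$ for all $f\in H$. Let $S_2(H)$ be the Hilbert space of Hilbert--Schmidt operators on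 $H$ with $\langle U_1,U_2\rangle=\operatorname{trace}(U_1^*U_2)$. For bounded operators $S,T$ on $H$ let $S\otimes T$ be the bounded operator on $S_2(H)$ given by $(S\otimes T)(O)=S\,O\,T^*$. For closed subspaces $X,Y\subseteq H$ let $X\otimes Y\subseteq S_2(H)$ be the closed subspace of Hilbert--Schmidt operators from $Y$ to $X$, extended by $0$ on $Y^\perp$. For weighted families $W=(W_j,w_j)_{j\in I}$ and $V=(V_i,v_i)_{i\in K}$ put $W\otimes V=(W_j\otimes V_i,\;w_jv_i)_{(j,i)\in I\times K}$. Let $W=(W_j,w_j)_{j\in I}$ and $V=(V_i,v_i)_{i\in K}$ be fusion frames for $H$. Then $W\otimes V$ is a fusion frame for $S_2(H)$, and: 1. The fusion frame operator of $W\otimes V$ is $S_{W\otimes V}=S_W\otimes S_V$. 2. $S_{W\otimes V}$ is invertible and $S_{W\otimes V}^{-1}=S_W^{-1}\otimes S_V^{-1}$. The canonical dual of $W\otimes V$ is the tensor product of the canonical duals: $\widetilde{W\otimes V}=\widetilde W\otimes\widetilde V$. 3. If $W'$ is a dual of $W$ and $V'$ is a dual of $V$, then $W'\otimes V'$ is a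 dual of $W\otimes V$. -/

import Mathlib

open scoped InnerProductSpace ENNReal

noncomputable section

namespace FusionFrames

/-! ### The Hilbert space of Hilbert-Schmidt operators -/

section HilbertSchmidt

variable {𝕜 E F : Type*} [RCLike 𝕜]
  [NormedAddCommGroup E] [InnerProductSpace 𝕜 E] [CompleteSpace E]
  [NormedAddCommGroup F] [InnerProductSpace 𝕜 F] [CompleteSpace F]

/-- Parseval's identity, in `[0, ∞]`. -/
theorem tsum_enorm_inner_sq {κ : Type*} (c : HilbertBasis κ 𝕜 F) (x : F) :
    ∑' j, ‖⟪c j, x⟫_𝕜‖ₑ ^ 2 = ‖x‖ₑ ^ 2 := by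
  have h1 : HasSum (fun j => ‖⟪c j, x⟫_𝕜‖ ^ 2) (‖x‖ ^ 2) := by
    have h := lp.hasSum_norm (p := 2) (by norm_num) (c.repr x)
    simpa [HilbertBasis.repr_apply_apply] using h
  have h2 := ENNReal.ofReal_tsum_of_nonneg (fun j => by positivity) h1.summable
  rw [h1.tsum_eq] at h2
  simp only [ENNReal.ofReal_pow (norm_nonneg _), ofReal_norm] at h2
  exact h2.symm

theorem tsum_enorm_adjoint {ι κ : Type*} (b : HilbertBasis ι 𝕜 E) (c : HilbertBasis κ 𝕜 F)
    (T : E →L[𝕜] F) :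
    ∑' j, ‖T.adjoint (c j)‖ₑ ^ 2 = ∑' i, ‖T (b i)‖ₑ ^ 2 := by
  simp_rw [← tsum_enorm_inner_sq c (T _), ← tsum_enorm_inner_sq b (T.adjoint _)]
  rw [ENNReal.tsum_comm]
  refine tsum_congr fun i => tsum_congr fun j => ?_
  rw [ContinuousLinearMap.adjoint_inner_right, ← enorm_norm, norm_inner_symm, enorm_norm]

/-- `∑ i, ‖T (b i)‖ ^ 2` does not depend on the orthonormal basis `b`. -/
theorem tsum_enorm_basis_indep {ι κ : Type*} (b : HilbertBasis ι 𝕜 E) (c : HilbertBasis κ 𝕜 E)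
    (T : E →L[𝕜] F) :
    ∑' i, ‖T (b i)‖ₑ ^ 2 = ∑' j, ‖T (c j)‖ₑ ^ 2 := by
  obtain ⟨w, d, -⟩ := exists_hilbertBasis 𝕜 F
  rw [← tsum_enorm_adjoint b d, ← tsum_enorm_adjoint c d]

theorem summable_norm_sq_iff {ι : Type*} (x : ι → F) :
    (Summable fun i => ‖x i‖ ^ 2) ↔ ∑' i, ‖x i‖ₑ ^ 2 ≠ ∞ := by
  constructor
  · intro h
    have h2 := ENNReal.ofReal_tsum_of_nonneg (fun j => by positivity) h
    simp only [ENNReal.ofReal_pow (norm_nonneg _), ofReal_norm] at h2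
    rw [← h2]
    exact ENNReal.ofReal_ne_top
  · intro h
    have := ENNReal.summable_toReal h
    simpa using this

theorem toReal_tsum_enorm_sq {ι : Type*} (x : ι → F) :
    (∑' i, ‖x i‖ₑ ^ 2).toReal = ∑' i, ‖x i‖ ^ 2 := by
  rw [ENNReal.tsum_toReal_eq (fun i => by finiteness)]
  simp

/-- `T` is a Hilbert-Schmidt operator: `∑ i, ‖T (b i)‖ ^ 2 < ∞` for some orthonormal basis `b` of
`E`; by `isHilbertSchmidt_iff` this is then so for every orthonormal basis. -/
def IsHilbertSchmidt (T : E →L[𝕜] F) : Prop :=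
  ∃ (s : Set E) (b : HilbertBasis s 𝕜 E), Summable fun i => ‖T (b i)‖ ^ 2

theorem isHilbertSchmidt_iff {ι : Type*} (b : HilbertBasis ι 𝕜 E) (T : E →L[𝕜] F) :
    IsHilbertSchmidt T ↔ Summable fun i => ‖T (b i)‖ ^ 2 := by
  constructor
  · rintro ⟨s, c, h⟩
    rw [summable_norm_sq_iff] at h ⊢
    rwa [tsum_enorm_basis_indep b c]
  · intro h
    obtain ⟨w, d, -⟩ := exists_hilbertBasis 𝕜 E
    refine ⟨w, d, ?_⟩
    rw [summable_norm_sq_iff] at h ⊢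
    rwa [tsum_enorm_basis_indep d b]

theorem isHilbertSchmidt_iff_memlp {ι : Type*} (b : HilbertBasis ι 𝕜 E) (T : E →L[𝕜] F) :
    IsHilbertSchmidt T ↔ Memℓp (fun i => T (b i)) 2 := by
  rw [isHilbertSchmidt_iff b, memℓp_gen_iff (by norm_num)]
  simp

theorem IsHilbertSchmidt.adjoint {T : E →L[𝕜] F} (hT : IsHilbertSchmidt T) :
    IsHilbertSchmidt T.adjoint := by
  obtain ⟨w, d, -⟩ := exists_hilbertBasis 𝕜 E
  obtain ⟨v, c, -⟩ := exists_hilbertBasis 𝕜 F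
  rw [isHilbertSchmidt_iff d, summable_norm_sq_iff] at hT
  rw [isHilbertSchmidt_iff c, summable_norm_sq_iff, tsum_enorm_adjoint d c]
  exact hT

variable (𝕜 E F) in
/-- The Hilbert-Schmidt operators as a linear subspace of the bounded operators. -/
def hilbertSchmidtSubmodule : Submodule 𝕜 (E →L[𝕜] F) where
  carrier := {T | IsHilbertSchmidt T}
  zero_mem' := by
    obtain ⟨w, d, -⟩ := exists_hilbertBasis 𝕜 E
    exact ⟨w, d, by simp⟩
  add_mem' := by
    intro S T hS hT
    obtain ⟨w, d, -⟩ := exists_hilbertBasis 𝕜 E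
    simp only [Set.mem_ofPred_eq] at *
    rw [isHilbertSchmidt_iff_memlp d] at *
    exact hS.add hT
  smul_mem' := by
    intro a T hT
    obtain ⟨w, d, -⟩ := exists_hilbertBasis 𝕜 E
    simp only [Set.mem_ofPred_eq] at *
    rw [isHilbertSchmidt_iff_memlp d] at *
    exact hT.const_smul a

variable (𝕜 E F) in
/-- The space `S₂(E, F)` of Hilbert-Schmidt operators from `E` to `F`. It is a type of its own
(and not the coerced submodule) because it carries the Hilbert-Schmidt norm and not the operator
norm. -/
def HilbertSchmidt : Type _ := hilbertSchmidtSubmodule 𝕜 E F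

instance : AddCommGroup (HilbertSchmidt 𝕜 E F) :=
  inferInstanceAs (AddCommGroup (hilbertSchmidtSubmodule 𝕜 E F))

instance : Module 𝕜 (HilbertSchmidt 𝕜 E F) :=
  inferInstanceAs (Module 𝕜 (hilbertSchmidtSubmodule 𝕜 E F))

namespace HilbertSchmidt

variable (𝕜 E F) in
/-- The inclusion of `S₂(E, F)` in the bounded operators. -/
def toCLM : HilbertSchmidt 𝕜 E F →ₗ[𝕜] (E →L[𝕜] F) :=
  (hilbertSchmidtSubmodule 𝕜 E F).subtype

instance : CoeFun (HilbertSchmidt 𝕜 E F) (fun _ => E → F) :=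
  ⟨fun T => toCLM 𝕜 E F T⟩

/-- A bounded operator that is Hilbert-Schmidt, as an element of `S₂(E, F)`. -/
def mk (T : E →L[𝕜] F) (hT : IsHilbertSchmidt T) : HilbertSchmidt 𝕜 E F := ⟨T, hT⟩

@[simp] theorem toCLM_mk (T : E →L[𝕜] F) (hT : IsHilbertSchmidt T) :
    toCLM 𝕜 E F (mk T hT) = T := rfl

theorem isHilbertSchmidt (T : HilbertSchmidt 𝕜 E F) : IsHilbertSchmidt (toCLM 𝕜 E F T) :=
  T.2

theorem toCLM_injective : Function.Injective (toCLM 𝕜 E F) := Subtype.val_injective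

@[ext] theorem ext {S T : HilbertSchmidt 𝕜 E F} (h : ∀ x, S x = T x) : S = T :=
  toCLM_injective (ContinuousLinearMap.ext h)

variable (F) in
/-- The family `(T (b i))` of the values of `T` on an orthonormal basis `b`. -/
def values {ι : Type*} (b : HilbertBasis ι 𝕜 E) :
    HilbertSchmidt 𝕜 E F →ₗ[𝕜] lp (fun _ : ι => F) 2 where
  toFun T := ⟨fun i => T (b i), (isHilbertSchmidt_iff_memlp b _).1 T.isHilbertSchmidt⟩
  map_add' S T := by
    ext i
    exact congrArg (fun A : E →L[𝕜] F => A (b i)) (map_add (toCLM 𝕜 E F) S T)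
  map_smul' a T := by
    ext i
    simp

@[simp] theorem values_apply {ι : Type*} (b : HilbertBasis ι 𝕜 E) (T : HilbertSchmidt 𝕜 E F)
    (i : ι) : values F b T i = T (b i) := rfl

theorem values_injective {ι : Type*} (b : HilbertBasis ι 𝕜 E) :
    Function.Injective (values F b) := by
  intro S T h
  apply toCLM_injective
  have hd : Dense (Submodule.span 𝕜 (Set.range b) : Set E) := by
    rw [Submodule.dense_iff_topologicalClosure_eq_top]
    exact b.dense_span
  refine ContinuousLinearMap.ext_on hd ?_
  rintro _ ⟨i, rfl⟩
  exact congrArg (fun f : lp (fun _ : ι => F) 2 => f i) h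

variable (𝕜 E) in
/-- An index set of an auxiliary orthonormal basis. -/
def stdIndex : Set E := (exists_hilbertBasis 𝕜 E).choose

variable (𝕜 E) in
/-- An auxiliary orthonormal basis. -/
def stdBasis : HilbertBasis (stdIndex 𝕜 E) 𝕜 E := (exists_hilbertBasis 𝕜 E).choose_spec.choose

/-- The inner product `trace (S* T) = ∑ i, ⟪S (b i), T (b i)⟫`; by `hasSum_inner` it does not
depend on the orthonormal basis `b`. -/
def traceInner (S T : HilbertSchmidt 𝕜 E F) : 𝕜 :=
  ∑' i, ⟪S (stdBasis 𝕜 E i), T (stdBasis 𝕜 E i)⟫_𝕜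

theorem traceInner_eq (S T : HilbertSchmidt 𝕜 E F) :
    traceInner S T = ⟪values F (stdBasis 𝕜 E) S, values F (stdBasis 𝕜 E) T⟫_𝕜 := by
  rw [lp.inner_eq_tsum]
  rfl

/-- The axioms of an inner product. -/
abbrev innerCore : InnerProductSpace.Core 𝕜 (HilbertSchmidt 𝕜 E F) where
  inner := traceInner
  conj_inner_symm S T := by simp only [traceInner_eq, inner_conj_symm]
  re_inner_nonneg S := by simp only [traceInner_eq, inner_self_nonneg]
  add_left S T U := by simp only [traceInner_eq, map_add, inner_add_left]
  smul_left S T a := by simp only [traceInner_eq, map_smul, inner_smul_left]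
  definite S h := by
    rw [traceInner_eq, inner_self_eq_zero] at h
    exact values_injective _ (h.trans (map_zero _).symm)

instance : NormedAddCommGroup (HilbertSchmidt 𝕜 E F) :=
  (innerCore (𝕜 := 𝕜) (E := E) (F := F)).toNormedAddCommGroup

instance : InnerProductSpace 𝕜 (HilbertSchmidt 𝕜 E F) := .ofCore innerCore.toCore

theorem inner_eq (S T : HilbertSchmidt 𝕜 E F) :
    ⟪S, T⟫_𝕜 = ⟪values F (stdBasis 𝕜 E) S, values F (stdBasis 𝕜 E) T⟫_𝕜 :=
  traceInner_eq S T

theorem norm_sq_eq {ι : Type*} (b : HilbertBasis ι 𝕜 E) (T : HilbertSchmidt 𝕜 E F) :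
    ‖T‖ ^ 2 = ∑' i, ‖T (b i)‖ ^ 2 := by
  rw [← toReal_tsum_enorm_sq, tsum_enorm_basis_indep b (stdBasis 𝕜 E), toReal_tsum_enorm_sq,
    ← inner_self_eq_norm_sq (𝕜 := 𝕜), inner_eq, inner_self_eq_norm_sq]
  simpa using lp.norm_rpow_eq_tsum (p := 2) (by norm_num) (values F (stdBasis 𝕜 E) T)

/-- The Hilbert-Schmidt norm is the `ℓ²` norm of the values on any orthonormal basis. -/
def valuesIsometry {ι : Type*} (b : HilbertBasis ι 𝕜 E) :
    HilbertSchmidt 𝕜 E F →ₗᵢ[𝕜] lp (fun _ : ι => F) 2 where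
  toLinearMap := values F b
  norm_map' T := by
    have h := lp.norm_rpow_eq_tsum (p := 2) (by norm_num) (values F b T)
    have h2 : ‖values F b T‖ ^ 2 = ‖T‖ ^ 2 := by
      rw [norm_sq_eq b]
      simpa using h
    exact (pow_left_inj₀ (norm_nonneg _) (norm_nonneg _) two_ne_zero).1 h2

theorem hasSum_inner {ι : Type*} (b : HilbertBasis ι 𝕜 E) (S T : HilbertSchmidt 𝕜 E F) :
    HasSum (fun i => ⟪S (b i), T (b i)⟫_𝕜) ⟪S, T⟫_𝕜 := by
  rw [← LinearIsometry.inner_map_map (valuesIsometry b) S T]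
  exact lp.hasSum_inner _ _

theorem valuesIsometry_surjective {ι : Type*} (b : HilbertBasis ι 𝕜 E) :
    Function.Surjective (valuesIsometry (F := F) b) := by
  intro x
  have hmem (y : F) : Memℓp (fun i => ⟪x i, y⟫_𝕜) 2 := by
    have h : Memℓp (fun i => ‖y‖ • ‖x i‖) 2 := (lp.memℓp x).norm.const_smul ‖y‖
    refine h.mono fun i => ?_
    rw [smul_eq_mul, mul_comm]
    exact norm_inner_le_norm _ _
  let A : F →ₗ[𝕜] lp (fun _ : ι => 𝕜) 2 :=
    { toFun := fun y => ⟨fun i => ⟪x i, y⟫_𝕜, hmem y⟩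
      map_add' := fun y z => by
        ext i
        exact inner_add_right _ _ _
      map_smul' := fun a y => by
        ext i
        simp [inner_smul_right] }
  have hA (y : F) : ‖A y‖ ≤ ‖x‖ * ‖y‖ := by
    refine lp.norm_le_of_forall_sum_le (p := 2) (by norm_num) (by positivity) fun s => ?_
    have h1 := lp.sum_rpow_le_norm_rpow (p := 2) (by norm_num) x s
    simp only [ENNReal.toReal_ofNat, Real.rpow_ofNat] at h1 ⊢
    calc ∑ i ∈ s, ‖A y i‖ ^ 2 ≤ ∑ i ∈ s, ‖x i‖ ^ 2 * ‖y‖ ^ 2 := by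
          refine Finset.sum_le_sum fun i _ => ?_
          rw [← mul_pow]
          exact pow_le_pow_left₀ (norm_nonneg _) (norm_inner_le_norm _ _) 2
      _ ≤ (‖x‖ * ‖y‖) ^ 2 := by
          rw [← Finset.sum_mul, mul_pow]
          gcongr
  let A' : F →L[𝕜] lp (fun _ : ι => 𝕜) 2 := A.mkContinuous ‖x‖ hA
  let R : F →L[𝕜] E := (b.repr.symm.toContinuousLinearEquiv : _ →L[𝕜] E) ∘L A'
  have hR (i : ι) : R.adjoint (b i) = x i := by
    refine ext_inner_right 𝕜 fun y => ?_
    rw [ContinuousLinearMap.adjoint_inner_left, ← HilbertBasis.repr_apply_apply]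
    simp [R, A', A]
  refine ⟨mk R.adjoint ?_, ?_⟩
  · rw [isHilbertSchmidt_iff_memlp b]
    simp_rw [hR]
    exact lp.memℓp x
  · ext i
    exact hR i

instance : CompleteSpace (HilbertSchmidt 𝕜 E F) := by
  let e := LinearIsometryEquiv.ofSurjective (valuesIsometry (F := F) (stdBasis 𝕜 E))
    (valuesIsometry_surjective _)
  exact (completeSpace_congr (e := e.toEquiv) e.isometry.isUniformEmbedding).2 inferInstance

theorem norm_apply_le (T : HilbertSchmidt 𝕜 E F) (x : E) : ‖T x‖ ≤ ‖T‖ * ‖x‖ := by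
  obtain ⟨w, c, -⟩ := exists_hilbertBasis 𝕜 F
  set A := toCLM 𝕜 E F T with hA
  have hfin : ∑' i, ‖A (stdBasis 𝕜 E i)‖ₑ ^ 2 ≠ ∞ :=
    (summable_norm_sq_iff _).1 ((isHilbertSchmidt_iff _ _).1 T.isHilbertSchmidt)
  have h1 : ‖A x‖ₑ ^ 2 ≤ (∑' i, ‖A (stdBasis 𝕜 E i)‖ₑ ^ 2) * ‖x‖ₑ ^ 2 := by
    rw [← tsum_enorm_inner_sq c, ← tsum_enorm_adjoint (stdBasis 𝕜 E) c, ← ENNReal.tsum_mul_right]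
    refine ENNReal.tsum_le_tsum fun j => ?_
    rw [← ContinuousLinearMap.adjoint_inner_left, ← mul_pow]
    gcongr
    simp only [← ofReal_norm]
    rw [← ENNReal.ofReal_mul (norm_nonneg _)]
    exact ENNReal.ofReal_le_ofReal (norm_inner_le_norm _ _)
  have h2 : ‖A x‖ ^ 2 ≤ (‖T‖ * ‖x‖) ^ 2 := by
    have := ENNReal.toReal_mono (by finiteness) h1
    rw [ENNReal.toReal_mul, toReal_tsum_enorm_sq, ← norm_sq_eq] at this
    simpa [mul_pow] using this
  exact (pow_le_pow_iff_left₀ (norm_nonneg _) (by positivity) two_ne_zero).1 h2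

end HilbertSchmidt

/-! ### Tensor products of operators and of subspaces -/

variable {E' F' : Type*}
  [NormedAddCommGroup E'] [InnerProductSpace 𝕜 E'] [CompleteSpace E']
  [NormedAddCommGroup F'] [InnerProductSpace 𝕜 F'] [CompleteSpace F']

theorem tsum_enorm_comp_left_le {ι : Type*} (b : HilbertBasis ι 𝕜 E) (S : F →L[𝕜] F')
    (O : E →L[𝕜] F) :
    ∑' i, ‖(S ∘L O) (b i)‖ₑ ^ 2 ≤ ‖S‖ₑ ^ 2 * ∑' i, ‖O (b i)‖ₑ ^ 2 := by
  rw [← ENNReal.tsum_mul_left]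
  refine ENNReal.tsum_le_tsum fun i => ?_
  rw [← mul_pow]
  gcongr
  exact S.le_opENorm _

theorem tsum_enorm_comp_right_le {ι κ : Type*} (b : HilbertBasis ι 𝕜 E) (c : HilbertBasis κ 𝕜 E')
    (O : E →L[𝕜] F) (R : E' →L[𝕜] E) :
    ∑' j, ‖(O ∘L R) (c j)‖ₑ ^ 2 ≤ ‖R‖ₑ ^ 2 * ∑' i, ‖O (b i)‖ₑ ^ 2 := by
  obtain ⟨w, d, -⟩ := exists_hilbertBasis 𝕜 F
  rw [← tsum_enorm_adjoint c d, ← tsum_enorm_adjoint b d, ContinuousLinearMap.adjoint_comp]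
  refine (tsum_enorm_comp_left_le d _ _).trans_eq ?_
  rw [← ofReal_norm, ← ofReal_norm, LinearIsometryEquiv.norm_map]

theorem IsHilbertSchmidt.comp_left {O : E →L[𝕜] F} (hO : IsHilbertSchmidt O) (S : F →L[𝕜] F') :
    IsHilbertSchmidt (S ∘L O) := by
  obtain ⟨v, b, -⟩ := exists_hilbertBasis 𝕜 E
  rw [isHilbertSchmidt_iff b, summable_norm_sq_iff] at hO ⊢
  exact ne_top_of_le_ne_top (by finiteness) (tsum_enorm_comp_left_le b S O)

theorem IsHilbertSchmidt.comp_right {O : E →L[𝕜] F} (hO : IsHilbertSchmidt O) (R : E' →L[𝕜] E) :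
    IsHilbertSchmidt (O ∘L R) := by
  obtain ⟨v, b, -⟩ := exists_hilbertBasis 𝕜 E
  obtain ⟨w, c, -⟩ := exists_hilbertBasis 𝕜 E'
  rw [isHilbertSchmidt_iff b, summable_norm_sq_iff] at hO
  rw [isHilbertSchmidt_iff c, summable_norm_sq_iff]
  exact ne_top_of_le_ne_top (by finiteness) (tsum_enorm_comp_right_le b c O R)

/-- The tensor product `S ⊗ T` of two bounded operators, `(S ⊗ T)(O) = S ∘ O ∘ T*`, as a bounded
operator between the spaces of Hilbert-Schmidt operators. -/
def tensorOperator (S : F →L[𝕜] F') (T : E →L[𝕜] E') :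
    HilbertSchmidt 𝕜 E F →L[𝕜] HilbertSchmidt 𝕜 E' F' :=
  LinearMap.mkContinuous
    { toFun := fun O => HilbertSchmidt.mk (S ∘L HilbertSchmidt.toCLM 𝕜 E F O ∘L T.adjoint)
        ((O.isHilbertSchmidt.comp_right _).comp_left _)
      map_add' := fun O P => by
        apply HilbertSchmidt.toCLM_injective
        simp
      map_smul' := fun a O => by
        apply HilbertSchmidt.toCLM_injective
        simp }
    (‖S‖ * ‖T‖) (fun O => by
      obtain ⟨v, b, -⟩ := exists_hilbertBasis 𝕜 E
      obtain ⟨w, c, -⟩ := exists_hilbertBasis 𝕜 E'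
      have hfin : ∑' i, ‖O (b i)‖ₑ ^ 2 ≠ ∞ :=
        (summable_norm_sq_iff _).1 ((isHilbertSchmidt_iff _ _).1 O.isHilbertSchmidt)
      have h1 := (tsum_enorm_comp_left_le c S (HilbertSchmidt.toCLM 𝕜 E F O ∘L T.adjoint)).trans
        (mul_le_mul_right (tsum_enorm_comp_right_le b c (HilbertSchmidt.toCLM 𝕜 E F O) T.adjoint) _)
      have h2 := ENNReal.toReal_mono (by finiteness) h1
      rw [ENNReal.toReal_mul, ENNReal.toReal_mul, toReal_tsum_enorm_sq, toReal_tsum_enorm_sq,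
        ← HilbertSchmidt.norm_sq_eq] at h2
      refine (pow_le_pow_iff_left₀ (norm_nonneg _) (by positivity) two_ne_zero).1 ?_
      rw [HilbertSchmidt.norm_sq_eq c]
      refine h2.trans_eq ?_
      simp [mul_pow, mul_assoc])

@[simp] theorem tensorOperator_apply (S : F →L[𝕜] F') (T : E →L[𝕜] E')
    (O : HilbertSchmidt 𝕜 E F) :
    HilbertSchmidt.toCLM 𝕜 E' F' (tensorOperator S T O) =
      S ∘L HilbertSchmidt.toCLM 𝕜 E F O ∘L T.adjoint := rfl

/-- The tensor product `W ⊗ V` of two subspaces: the Hilbert-Schmidt operators from `V` to `W`,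
extended by `0` on the orthogonal complement of `V` and so considered as elements of `S₂(E, F)`;
see `mem_tensorSubspace_iff`. -/
def tensorSubspace (W : Submodule 𝕜 F) (V : Submodule 𝕜 E) :
    Submodule 𝕜 (HilbertSchmidt 𝕜 E F) where
  carrier := {O | (∀ x, O x ∈ W) ∧ ∀ x ∈ Vᗮ, O x = 0}
  zero_mem' := ⟨fun x => by simp, fun x _ => by simp⟩
  add_mem' := by
    rintro O P ⟨h1, h2⟩ ⟨h3, h4⟩
    exact ⟨fun x => by simpa using W.add_mem (h1 x) (h3 x),
      fun x hx => by simp [h2 x hx, h4 x hx]⟩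
  smul_mem' := by
    rintro a O ⟨h1, h2⟩
    exact ⟨fun x => by simpa using W.smul_mem a (h1 x), fun x hx => by simp [h2 x hx]⟩

theorem mem_tensorSubspace {W : Submodule 𝕜 F} {V : Submodule 𝕜 E} {O : HilbertSchmidt 𝕜 E F} :
    O ∈ tensorSubspace W V ↔ (∀ x, O x ∈ W) ∧ ∀ x ∈ Vᗮ, O x = 0 := Iff.rfl

/-- `W ⊗ V` is the copy in `S₂(E, F)` of the space `S₂(V, W)`. -/
theorem mem_tensorSubspace_iff (W : Submodule 𝕜 F) (V : Submodule 𝕜 E) [CompleteSpace W]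
    [CompleteSpace V] (O : HilbertSchmidt 𝕜 E F) :
    O ∈ tensorSubspace W V ↔ ∃ U : HilbertSchmidt 𝕜 V W, HilbertSchmidt.toCLM 𝕜 E F O =
      W.subtypeL ∘L HilbertSchmidt.toCLM 𝕜 V W U ∘L V.orthogonalProjectionOnto := by
  rw [mem_tensorSubspace]
  constructor
  · rintro ⟨h1, h2⟩
    refine ⟨.mk (W.orthogonalProjectionOnto ∘L HilbertSchmidt.toCLM 𝕜 E F O ∘L V.subtypeL)
      ((O.isHilbertSchmidt.comp_right _).comp_left _), ?_⟩
    ext x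
    have h3 := h2 _ (V.sub_starProjection_mem_orthogonal x)
    rw [map_sub, sub_eq_zero] at h3
    rw [h3]
    exact (Submodule.starProjection_eq_self_iff.2 (h1 _)).symm
  · rintro ⟨U, hU⟩
    rw [hU]
    refine ⟨fun x => Submodule.coe_mem _, fun x hx => ?_⟩
    simp [Submodule.orthogonalProjectionOnto_eq_zero_iff.2 hx]

theorem isClosed_tensorSubspace {W : Submodule 𝕜 F} (hW : IsClosed (W : Set F))
    (V : Submodule 𝕜 E) :
    IsClosed (tensorSubspace W V : Set (HilbertSchmidt 𝕜 E F)) := by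
  have hev (x : E) : Continuous fun O : HilbertSchmidt 𝕜 E F => O x := by
    let ev : HilbertSchmidt 𝕜 E F →ₗ[𝕜] F :=
      (ContinuousLinearMap.apply 𝕜 F x).toLinearMap ∘ₗ HilbertSchmidt.toCLM 𝕜 E F
    exact (ev.mkContinuous ‖x‖ fun O => by
      rw [mul_comm]
      exact O.norm_apply_le x).continuous
  have h : (tensorSubspace W V : Set (HilbertSchmidt 𝕜 E F)) =
      (⋂ x, {O | O x ∈ W}) ∩ ⋂ x ∈ Vᗮ, {O | O x = 0} := by
    ext O
    simp [mem_tensorSubspace]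
  rw [h]
  exact (isClosed_iInter fun x => hW.preimage (hev x)).inter
    (isClosed_biInter fun x _ => isClosed_eq (hev x) continuous_const)

end HilbertSchmidt

/-! ### Fusion frames -/

/-- A family `(W i, w i)` of closed subspaces of `H` with weights `w i > 0`. -/
structure WeightedSubspaces (𝕜 H ι : Type*) [RCLike 𝕜] [NormedAddCommGroup H]
    [InnerProductSpace 𝕜 H] where
  space : ι → Submodule 𝕜 H
  isClosed_space : ∀ i, IsClosed (space i : Set H)
  weight : ι → ℝ
  weight_pos : ∀ i, 0 < weight i

namespace WeightedSubspaces

variable {𝕜 H ι κ : Type*} [RCLike 𝕜] [NormedAddCommGroup H] [InnerProductSpace 𝕜 H]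
  [CompleteSpace H]

instance (W : WeightedSubspaces 𝕜 H ι) (i : ι) : CompleteSpace (W.space i) :=
  (W.isClosed_space i).completeSpace_coe

/-- The orthogonal projection `π` of `H` onto the `i`-th subspace. -/
abbrev proj (W : WeightedSubspaces 𝕜 H ι) (i : ι) : H →L[𝕜] H := (W.space i).starProjection

/-- `W` is a Bessel fusion sequence: `∑ i, (w i)² ‖π i f‖² ≤ B ‖f‖²` for all `f`. -/
def IsBessel (W : WeightedSubspaces 𝕜 H ι) : Prop :=
  ∃ B : ℝ, ∀ f : H, (Summable fun i => W.weight i ^ 2 * ‖W.proj i f‖ ^ 2) ∧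
    ∑' i, W.weight i ^ 2 * ‖W.proj i f‖ ^ 2 ≤ B * ‖f‖ ^ 2

/-- `W` is a fusion frame: `A ‖f‖² ≤ ∑ i, (w i)² ‖π i f‖² ≤ B ‖f‖²` for all `f`. -/
def IsFusionFrame (W : WeightedSubspaces 𝕜 H ι) : Prop :=
  ∃ A B : ℝ, 0 < A ∧ A ≤ B ∧ ∀ f : H, (Summable fun i => W.weight i ^ 2 * ‖W.proj i f‖ ^ 2) ∧
    A * ‖f‖ ^ 2 ≤ ∑' i, W.weight i ^ 2 * ‖W.proj i f‖ ^ 2 ∧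
    ∑' i, W.weight i ^ 2 * ‖W.proj i f‖ ^ 2 ≤ B * ‖f‖ ^ 2

variable {W : WeightedSubspaces 𝕜 H ι}

theorem IsFusionFrame.isBessel (hW : W.IsFusionFrame) : W.IsBessel := by
  obtain ⟨A, B, -, -, h⟩ := hW
  exact ⟨B, fun f => ⟨(h f).1, (h f).2.2⟩⟩

theorem norm_weight_smul_sq (W : WeightedSubspaces 𝕜 H ι) (f : H) (i : ι) :
    ‖(W.weight i : 𝕜) • (W.space i).orthogonalProjectionOnto f‖ ^ 2 =
      W.weight i ^ 2 * ‖W.proj i f‖ ^ 2 := by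
  rw [norm_smul, mul_pow, RCLike.norm_ofReal, sq_abs]
  rfl

theorem IsBessel.memlp (hW : W.IsBessel) (f : H) :
    Memℓp (fun i => (W.weight i : 𝕜) • (W.space i).orthogonalProjectionOnto f) 2 := by
  obtain ⟨B, h⟩ := hW
  rw [memℓp_gen_iff (by norm_num)]
  simpa only [ENNReal.toReal_ofNat, Real.rpow_ofNat, norm_weight_smul_sq] using (h f).1

/-- The analysis operator `f ↦ (w i • π i f)` of a Bessel fusion sequence, with values in the
Hilbert space `(⨁ W i)_{ℓ²}`. -/
def IsBessel.analysis (hW : W.IsBessel) : H →L[𝕜] lp (fun i => W.space i) 2 :=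
  LinearMap.mkContinuousOfExistsBound
    { toFun := fun f => ⟨fun i => (W.weight i : 𝕜) • (W.space i).orthogonalProjectionOnto f,
        hW.memlp f⟩
      map_add' := fun f g => by
        refine lp.ext (funext fun i => ?_)
        exact (congrArg _ (map_add _ f g)).trans (smul_add _ _ _)
      map_smul' := fun a f => by
        refine lp.ext (funext fun i => ?_)
        exact (congrArg _ (map_smul _ a f)).trans (smul_comm _ _ _) }
    (by
      obtain ⟨B, h⟩ := id hW
      refine ⟨Real.sqrt B, fun f => ?_⟩
      refine lp.norm_le_of_tsum_le (p := 2) (by norm_num) (by positivity) ?_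
      simp only [ENNReal.toReal_ofNat, Real.rpow_ofNat, LinearMap.coe_mk, AddHom.coe_mk,
        norm_weight_smul_sq]
      refine (h f).2.trans ?_
      rw [mul_pow]
      gcongr
      by_cases hB : 0 ≤ B
      · rw [Real.sq_sqrt hB]
      · exact (not_le.1 hB).le.trans (sq_nonneg _))

theorem IsBessel.analysis_apply (hW : W.IsBessel) (f : H) (i : ι) :
    (hW.analysis f i : H) = (W.weight i : 𝕜) • W.proj i f := rfl

/-- The synthesis operator `(f i) ↦ ∑ i, w i • f i` of a Bessel fusion sequence (see
`hasSum_synthesis`), the adjoint of the analysis operator. -/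
def IsBessel.synthesis (hW : W.IsBessel) : lp (fun i => W.space i) 2 →L[𝕜] H :=
  hW.analysis.adjoint

theorem IsBessel.synthesis_single [DecidableEq ι] (hW : W.IsBessel) (i : ι) (x : W.space i) :
    hW.synthesis (lp.single 2 i x) = (W.weight i : 𝕜) • (x : H) := by
  refine ext_inner_right 𝕜 fun y => ?_
  rw [IsBessel.synthesis, ContinuousLinearMap.adjoint_inner_left, lp.inner_single_left,
    Submodule.coe_inner, hW.analysis_apply, inner_smul_left, inner_smul_right, RCLike.conj_ofReal,
    ← Submodule.inner_starProjection_left_eq_right, Submodule.starProjection_eq_self_iff.2 x.2]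

theorem IsBessel.hasSum_synthesis (hW : W.IsBessel) (f : lp (fun i => W.space i) 2) :
    HasSum (fun i => (W.weight i : 𝕜) • (f i : H)) (hW.synthesis f) := by
  classical
  have h := (lp.hasSum_single (p := 2) (by norm_num) f).mapL hW.synthesis
  simpa only [hW.synthesis_single] using h

/-- The fusion frame operator `S_W = T_W T_W*`. -/
def IsBessel.frameOperator (hW : W.IsBessel) : H →L[𝕜] H := hW.synthesis ∘L hW.analysis

theorem IsBessel.hasSum_frameOperator (hW : W.IsBessel) (f : H) :
    HasSum (fun i => ((W.weight i ^ 2 : ℝ) : 𝕜) • W.proj i f) (hW.frameOperator f) := by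
  have h := hW.hasSum_synthesis (hW.analysis f)
  simp only [hW.analysis_apply, smul_smul] at h
  simp only [sq, RCLike.ofReal_mul]
  exact h

theorem IsBessel.inner_frameOperator (hW : W.IsBessel) (f : H) :
    ⟪hW.frameOperator f, f⟫_𝕜 = ((∑' i, W.weight i ^ 2 * ‖W.proj i f‖ ^ 2 : ℝ) : 𝕜) := by
  have h := lp.norm_rpow_eq_tsum (p := 2) (by norm_num) (hW.analysis f)
  simp only [ENNReal.toReal_ofNat, Real.rpow_ofNat] at h
  rw [IsBessel.frameOperator, ContinuousLinearMap.comp_apply, IsBessel.synthesis,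
    ContinuousLinearMap.adjoint_inner_left, inner_self_eq_norm_sq_to_K, ← RCLike.ofReal_pow, h]
  congr 1
  exact tsum_congr fun i => norm_weight_smul_sq W f i

/-- The fusion frame operator of a fusion frame is invertible. -/
theorem IsFusionFrame.isInvertible_frameOperator (hW : W.IsFusionFrame) :
    hW.isBessel.frameOperator.IsInvertible := by
  obtain ⟨A, B, hA, -, h⟩ := id hW
  have hu : IsUnit hW.isBessel.frameOperator := by
    refine ContinuousLinearMap.isUnit_of_forall_le_norm_inner_map _ (c := ⟨A, hA.le⟩) hA fun f => ?_
    rw [hW.isBessel.inner_frameOperator, RCLike.norm_ofReal, mul_comm]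
    exact (h f).2.1.trans (le_abs_self _)
  obtain ⟨u, hu⟩ := hu
  exact ⟨ContinuousLinearEquiv.unitsEquiv 𝕜 H u, hu⟩

/-- The inverse `S_W⁻¹` of the fusion frame operator. -/
def IsFusionFrame.invFrameOperator (hW : W.IsFusionFrame) : H →L[𝕜] H :=
  hW.isBessel.frameOperator.inverse

/-- The canonical dual `(S_W⁻¹ W i, w i)` of a fusion frame `W`. -/
def IsFusionFrame.canonicalDual (hW : W.IsFusionFrame) : WeightedSubspaces 𝕜 H ι where
  space i := (W.space i).map hW.invFrameOperator.toLinearMap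
  isClosed_space i := by
    obtain ⟨e, he⟩ := hW.isInvertible_frameOperator
    have h : hW.invFrameOperator = (e.symm : H →L[𝕜] H) := by
      rw [IsFusionFrame.invFrameOperator, ← he, ContinuousLinearMap.inverse_equiv]
    rw [h, Submodule.map_coe]
    exact e.symm.toHomeomorph.isClosedMap _ (W.isClosed_space i)
  weight := W.weight
  weight_pos := W.weight_pos

/-- `V` is a (Găvruţa or alternate) dual of the fusion frame `W`: `V` is a Bessel fusion sequence
and `f = ∑ i, w i v i π_{V i} S_W⁻¹ π_{W i} f` for all `f`. -/
def IsFusionFrame.IsDual (hW : W.IsFusionFrame) (V : WeightedSubspaces 𝕜 H ι) : Prop :=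
  V.IsBessel ∧ ∀ f : H,
    HasSum (fun i => ((W.weight i * V.weight i : ℝ) : 𝕜) •
      V.proj i (hW.invFrameOperator (W.proj i f))) f

/-- The tensor product `W ⊗ V = (W j ⊗ V i, w j v i)`, a family of closed subspaces of `S₂(H)`. -/
def tensor (W : WeightedSubspaces 𝕜 H ι) (V : WeightedSubspaces 𝕜 H κ) :
    WeightedSubspaces 𝕜 (HilbertSchmidt 𝕜 H H) (ι × κ) where
  space p := tensorSubspace (W.space p.1) (V.space p.2)
  isClosed_space p := isClosed_tensorSubspace (W.isClosed_space p.1) _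
  weight p := W.weight p.1 * V.weight p.2
  weight_pos p := mul_pos (W.weight_pos p.1) (V.weight_pos p.2)

end WeightedSubspaces

end FusionFrames

end

open scoped InnerProductSpace ENNReal NNReal

noncomputable section

namespace FusionFrames

/-! Everything rests on the identity `π_{X ⊗ Y} = π_X ⊗ π_Y` (`starProjection_tensorSubspace`),
which follows from `(S ⊗ T)* = S* ⊗ T*` (`inner_tensorOperator`).

Frame bounds: expand the Hilbert-Schmidt norm over an orthonormal basis `b`. The frame sum of `W ⊗
V` at `O` becomes the sum over `i, k` of the frame sums of `W` at the vectors `v_i O π_{V_i} b_k`.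
The bounds of `W` reduce this to `∑ ‖v_i O π_{V_i} b_k‖²`, and passing to adjoints turns that into
the frame sums of `V` at the vectors `O* b_k`. Since `O` and `O*` have the same Hilbert-Schmidt
norm, the bounds multiply. With sums in `[0, ∞]` every exchange is free.

Operator identities: the Bessel property already gives convergence of the double series in `S₂(H)`,
so only its sum must be identified. This is done after evaluation at a vector, summing first over
`i` and then over `j` (`tensorOperator_eq_of_hasSum`). The second factor enters there through
adjoints, so the statement on duals needs the duality relation to be symmetric
(`IsFusionFrame.IsDual.hasSum_adjoint`). Inverses and canonical duals follow from functoriality of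
`⊗`. -/

theorem map_symm_map {𝕜 F F' : Type*} [RCLike 𝕜] [NormedAddCommGroup F] [NormedSpace 𝕜 F]
    [NormedAddCommGroup F'] [NormedSpace 𝕜 F'] (e : F ≃L[𝕜] F') (W : Submodule 𝕜 F) :
    (W.map (e : F →L[𝕜] F').toLinearMap).map (e.symm : F' →L[𝕜] F).toLinearMap = W := by
  rw [← Submodule.map_comp]
  convert Submodule.map_id W
  ext
  simp

/-! ### Adjoints and projections on the Hilbert-Schmidt operators -/

section HilbertSchmidt

variable {𝕜 E F E' F' E'' F'' : Type*} [RCLike 𝕜]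
  [NormedAddCommGroup E] [InnerProductSpace 𝕜 E] [CompleteSpace E]
  [NormedAddCommGroup F] [InnerProductSpace 𝕜 F] [CompleteSpace F]
  [NormedAddCommGroup E'] [InnerProductSpace 𝕜 E'] [CompleteSpace E']
  [NormedAddCommGroup F'] [InnerProductSpace 𝕜 F'] [CompleteSpace F']
  [NormedAddCommGroup E''] [InnerProductSpace 𝕜 E''] [CompleteSpace E'']
  [NormedAddCommGroup F''] [InnerProductSpace 𝕜 F''] [CompleteSpace F'']

namespace HilbertSchmidt

theorem enorm_sq_eq {ι : Type*} (b : HilbertBasis ι 𝕜 E) (T : HilbertSchmidt 𝕜 E F) :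
    ‖T‖ₑ ^ 2 = ∑' i, ‖T (b i)‖ₑ ^ 2 := by
  have hfin : ∑' i, ‖T (b i)‖ₑ ^ 2 ≠ ∞ :=
    (summable_norm_sq_iff _).1 ((isHilbertSchmidt_iff _ _).1 T.isHilbertSchmidt)
  rw [← ENNReal.toReal_eq_toReal_iff' (by finiteness) hfin, toReal_tsum_enorm_sq, ← norm_sq_eq]
  simp

/-- The adjoint of a Hilbert-Schmidt operator. -/
def adj (T : HilbertSchmidt 𝕜 E F) : HilbertSchmidt 𝕜 F E :=
  mk (toCLM 𝕜 E F T).adjoint T.isHilbertSchmidt.adjoint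

@[simp] theorem toCLM_adj (T : HilbertSchmidt 𝕜 E F) :
    toCLM 𝕜 F E T.adj = (toCLM 𝕜 E F T).adjoint := rfl

theorem adj_add (S T : HilbertSchmidt 𝕜 E F) : (S + T).adj = S.adj + T.adj :=
  toCLM_injective (by simp)

theorem adj_smul (a : 𝕜) (T : HilbertSchmidt 𝕜 E F) : (a • T).adj = star a • T.adj :=
  toCLM_injective (by simp [LinearIsometryEquiv.map_smulₛₗ])

theorem norm_adj (T : HilbertSchmidt 𝕜 E F) : ‖T.adj‖ = ‖T‖ := by
  rw [← pow_left_inj₀ (norm_nonneg _) (norm_nonneg _) two_ne_zero, norm_sq_eq (stdBasis 𝕜 F),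
    norm_sq_eq (stdBasis 𝕜 E), ← toReal_tsum_enorm_sq, ← toReal_tsum_enorm_sq, toCLM_adj,
    tsum_enorm_adjoint (stdBasis 𝕜 E)]

/-- The adjoint is a conjugate-linear isometry, so polarization applies: conjugating the scalars
exchanges `I` and `-I`, which conjugates the inner product. -/
theorem inner_adj (S T : HilbertSchmidt 𝕜 E F) : ⟪S.adj, T.adj⟫_𝕜 = ⟪T, S⟫_𝕜 := by
  have h (a : 𝕜) : ‖S.adj + a • T.adj‖ = ‖S + star a • T‖ := by
    rw [← norm_adj (S + _), adj_add, adj_smul, star_star]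
  have h1 := h 1
  have h2 := h (-1)
  have h3 := h RCLike.I
  have h4 := h (-RCLike.I)
  simp only [RCLike.star_def, map_neg, map_one, RCLike.conj_I, one_smul, neg_smul, neg_neg,
    ← sub_eq_add_neg] at h1 h2 h3 h4
  rw [← inner_conj_symm T S, inner_eq_sum_norm_sq_div_four, inner_eq_sum_norm_sq_div_four,
    h1, h2, h3, h4]
  simp only [map_div₀, map_add, map_sub, map_mul, map_pow, RCLike.conj_ofReal, RCLike.conj_I,
    map_ofNat]
  ring

variable (𝕜 F) in
/-- Evaluation at a vector, as a bounded operator on the Hilbert-Schmidt operators. -/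
def eval (x : E) : HilbertSchmidt 𝕜 E F →L[𝕜] F :=
  ((ContinuousLinearMap.apply 𝕜 F x).toLinearMap ∘ₗ toCLM 𝕜 E F).mkContinuous ‖x‖ fun O => by
    rw [mul_comm]
    exact O.norm_apply_le x

end HilbertSchmidt

open HilbertSchmidt

theorem tensorOperator_comp (S' : F' →L[𝕜] F'') (T' : E' →L[𝕜] E'') (S : F →L[𝕜] F')
    (T : E →L[𝕜] E') :
    tensorOperator S' T' ∘L tensorOperator S T = tensorOperator (S' ∘L S) (T' ∘L T) := by
  ext O x
  simp [ContinuousLinearMap.adjoint_comp]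

theorem tensorOperator_id :
    tensorOperator (.id 𝕜 F) (.id 𝕜 E) = .id 𝕜 (HilbertSchmidt 𝕜 E F) := by
  ext O x
  simp [ContinuousLinearMap.adjoint_id]

theorem inner_tensorOperator_id_left (S : F →L[𝕜] F') (O : HilbertSchmidt 𝕜 E F)
    (P : HilbertSchmidt 𝕜 E F') :
    ⟪tensorOperator S (.id 𝕜 E) O, P⟫_𝕜 = ⟪O, tensorOperator S.adjoint (.id 𝕜 E) P⟫_𝕜 := by
  refine (hasSum_inner (stdBasis 𝕜 E) _ _).unique ?_
  convert hasSum_inner (stdBasis 𝕜 E) O (tensorOperator S.adjoint (.id 𝕜 E) P) using 2 with i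
  simp [ContinuousLinearMap.adjoint_id, ContinuousLinearMap.adjoint_inner_right]

theorem adj_tensorOperator (S : F →L[𝕜] F') (T : E →L[𝕜] E') (O : HilbertSchmidt 𝕜 E F) :
    (tensorOperator S T O).adj = tensorOperator T S O.adj :=
  toCLM_injective (by simp [ContinuousLinearMap.adjoint_comp, ContinuousLinearMap.comp_assoc])

/-- Taking adjoints exchanges the two tensor factors, which reduces this to the left factor, where
the identity holds term by term on a basis. -/
theorem inner_tensorOperator_id_right (T : E →L[𝕜] E') (O : HilbertSchmidt 𝕜 E F)
    (P : HilbertSchmidt 𝕜 E' F) :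
    ⟪tensorOperator (.id 𝕜 F) T O, P⟫_𝕜 = ⟪O, tensorOperator (.id 𝕜 F) T.adjoint P⟫_𝕜 := by
  rw [← inner_adj, ← inner_adj _ O, adj_tensorOperator, adj_tensorOperator,
    ← inner_conj_symm, inner_tensorOperator_id_left, inner_conj_symm]

theorem inner_tensorOperator (S : F →L[𝕜] F') (T : E →L[𝕜] E') (O : HilbertSchmidt 𝕜 E F)
    (P : HilbertSchmidt 𝕜 E' F') :
    ⟪tensorOperator S T O, P⟫_𝕜 = ⟪O, tensorOperator S.adjoint T.adjoint P⟫_𝕜 := by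
  -- Factoring through `S ⊗ 1` and `1 ⊗ T` treats one side at a time.
  have h1 : tensorOperator S T O =
      tensorOperator S (.id 𝕜 E') (tensorOperator (.id 𝕜 F) T O) := by
    rw [← ContinuousLinearMap.comp_apply, tensorOperator_comp]
    rfl
  have h2 : tensorOperator S.adjoint T.adjoint P =
      tensorOperator (.id 𝕜 F) T.adjoint (tensorOperator S.adjoint (.id 𝕜 E') P) := by
    rw [← ContinuousLinearMap.comp_apply, tensorOperator_comp]
    rfl
  rw [h1, h2, inner_tensorOperator_id_left, inner_tensorOperator_id_right]

/-- The orthogonal projection onto `W ⊗ V` is the tensor product of the orthogonal projections. -/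
theorem starProjection_tensorSubspace (W : Submodule 𝕜 F) (V : Submodule 𝕜 E) [CompleteSpace W]
    [CompleteSpace V] [(tensorSubspace W V).HasOrthogonalProjection] :
    (tensorSubspace W V).starProjection =
      tensorOperator W.starProjection V.starProjection := by
  ext1 O
  refine Submodule.eq_starProjection_of_mem_of_inner_eq_zero ?_ fun P hP => ?_
  · refine mem_tensorSubspace.2 ⟨fun x => ?_, fun x hx => ?_⟩
    · simp
    · simp [(isSelfAdjoint_starProjection V).adjoint_eq,
        (Submodule.starProjection_apply_eq_zero_iff V).2 hx]
  -- Elements of `W ⊗ V` are fixed by `π_W ⊗ π_V`; as this operator is self-adjoint, the residual of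
  -- `O` is orthogonal to them.
  · have h : tensorOperator W.starProjection V.starProjection P = P := by
      refine HilbertSchmidt.ext fun x => ?_
      -- `P` vanishes on `Vᗮ`, so `P x = P (π_V x)`.
      have h3 := hP.2 _ (V.sub_starProjection_mem_orthogonal x)
      rw [map_sub, sub_eq_zero] at h3
      simp [(isSelfAdjoint_starProjection V).adjoint_eq, ← h3,
        Submodule.starProjection_eq_self_iff.2 (hP.1 x)]
    rw [inner_sub_left, inner_tensorOperator, (isSelfAdjoint_starProjection V).adjoint_eq,
      (isSelfAdjoint_starProjection W).adjoint_eq, h, sub_self]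

theorem tensorOperator_inverse {S : F →L[𝕜] F'} {T : E →L[𝕜] E'} (hS : S.IsInvertible)
    (hT : T.IsInvertible) :
    (tensorOperator S T).IsInvertible ∧
      (tensorOperator S T).inverse = tensorOperator S.inverse T.inverse := by
  have h1 : tensorOperator S T ∘L tensorOperator S.inverse T.inverse = .id _ _ := by
    rw [tensorOperator_comp, hS.self_comp_inverse, hT.self_comp_inverse, tensorOperator_id]
  have h2 : tensorOperator S.inverse T.inverse ∘L tensorOperator S T = .id _ _ := by
    rw [tensorOperator_comp, hS.inverse_comp_self, hT.inverse_comp_self, tensorOperator_id]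
  exact ⟨.of_inverse h1 h2, ContinuousLinearMap.inverse_eq h1 h2⟩

theorem tensorOperator_mem_tensorSubspace_map (S : F →L[𝕜] F') (T : E →L[𝕜] E')
    {W : Submodule 𝕜 F} {V : Submodule 𝕜 E} {O : HilbertSchmidt 𝕜 E F}
    (hO : O ∈ tensorSubspace W V) :
    tensorOperator S T O ∈ tensorSubspace (W.map S.toLinearMap) (V.map T.toLinearMap) := by
  refine mem_tensorSubspace.2 ⟨fun x => ⟨_, hO.1 (T.adjoint x), rfl⟩, fun x hx => ?_⟩
  -- The adjoint of `T` carries `(T V)ᗮ` into `Vᗮ`; invertibility is not needed for this inclusion.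
  have hx' : T.adjoint x ∈ Vᗮ := by
    refine (Submodule.mem_orthogonal _ _).2 fun v hv => ?_
    rw [ContinuousLinearMap.adjoint_inner_right]
    exact (Submodule.mem_orthogonal _ _).1 hx _ ⟨v, hv, rfl⟩
  simp [hO.2 _ hx']

/-- The image of `W ⊗ V` under `S ⊗ T`, for invertible `S` and `T`. -/
theorem map_tensorSubspace (e : F ≃L[𝕜] F') (g : E ≃L[𝕜] E') (W : Submodule 𝕜 F)
    (V : Submodule 𝕜 E) :
    (tensorSubspace W V).map (tensorOperator (e : F →L[𝕜] F') (g : E →L[𝕜] E')).toLinearMap =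
      tensorSubspace (W.map (e : F →L[𝕜] F').toLinearMap)
        (V.map (g : E →L[𝕜] E').toLinearMap) := by
  refine le_antisymm ?_ fun P hP => ?_
  · rintro _ ⟨O, hO, rfl⟩
    exact tensorOperator_mem_tensorSubspace_map _ _ hO
  -- The reverse inclusion is the forward one for the inverse operators.
  · refine ⟨tensorOperator (e.symm : F' →L[𝕜] F) (g.symm : E' →L[𝕜] E) P, ?_, ?_⟩
    · have h := tensorOperator_mem_tensorSubspace_map (e.symm : F' →L[𝕜] F)
        (g.symm : E' →L[𝕜] E) hP
      rwa [map_symm_map, map_symm_map] at h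
    · rw [ContinuousLinearMap.coe_coe, ← ContinuousLinearMap.comp_apply, tensorOperator_comp]
      simp [tensorOperator_id]

end HilbertSchmidt

/-! ### Frame sums in `[0, ∞]` -/

namespace WeightedSubspaces

variable {𝕜 H ι κ : Type*} [RCLike 𝕜] [NormedAddCommGroup H] [InnerProductSpace 𝕜 H]
  [CompleteSpace H]

/-- The sum `∑ i, (w i)² ‖π i f‖²`, in `[0, ∞]`. -/
def frameSum (W : WeightedSubspaces 𝕜 H ι) (f : H) : ℝ≥0∞ :=
  ∑' i, ‖(W.weight i : 𝕜) • W.proj i f‖ₑ ^ 2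

theorem norm_smul_proj_sq (W : WeightedSubspaces 𝕜 H ι) (f : H) (i : ι) :
    ‖(W.weight i : 𝕜) • W.proj i f‖ ^ 2 = W.weight i ^ 2 * ‖W.proj i f‖ ^ 2 :=
  W.norm_weight_smul_sq f i

theorem summable_iff_frameSum (W : WeightedSubspaces 𝕜 H ι) (f : H) :
    (Summable fun i => W.weight i ^ 2 * ‖W.proj i f‖ ^ 2) ↔ W.frameSum f ≠ ∞ := by
  simp only [← norm_smul_proj_sq]
  exact summable_norm_sq_iff _

theorem toReal_frameSum (W : WeightedSubspaces 𝕜 H ι) (f : H) :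
    (W.frameSum f).toReal = ∑' i, W.weight i ^ 2 * ‖W.proj i f‖ ^ 2 := by
  simp only [← norm_smul_proj_sq]
  exact toReal_tsum_enorm_sq _

/-- In `[0, ∞]` a finite upper bound encodes summability as well as the estimate. -/
theorem frameSum_le_iff (W : WeightedSubspaces 𝕜 H ι) (f : H) (B : ℝ≥0) :
    W.frameSum f ≤ B * ‖f‖ₑ ^ 2 ↔
      (Summable fun i => W.weight i ^ 2 * ‖W.proj i f‖ ^ 2) ∧
        ∑' i, W.weight i ^ 2 * ‖W.proj i f‖ ^ 2 ≤ B * ‖f‖ ^ 2 := by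
  rw [summable_iff_frameSum, ← toReal_frameSum]
  have hr : (B * ‖f‖ₑ ^ 2 : ℝ≥0∞).toReal = B * ‖f‖ ^ 2 := by simp
  rw [← hr]
  constructor
  · intro h
    exact ⟨ne_top_of_le_ne_top (by finiteness) h, ENNReal.toReal_mono (by finiteness) h⟩
  · rintro ⟨h1, h2⟩
    exact (ENNReal.toReal_le_toReal h1 (by finiteness)).1 h2

theorem le_frameSum_iff (W : WeightedSubspaces 𝕜 H ι) (f : H) (A : ℝ≥0)
    (h : Summable fun i => W.weight i ^ 2 * ‖W.proj i f‖ ^ 2) :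
    A * ‖f‖ₑ ^ 2 ≤ W.frameSum f ↔ A * ‖f‖ ^ 2 ≤ ∑' i, W.weight i ^ 2 * ‖W.proj i f‖ ^ 2 := by
  rw [← toReal_frameSum]
  have hr : (A * ‖f‖ₑ ^ 2 : ℝ≥0∞).toReal = A * ‖f‖ ^ 2 := by simp
  rw [← hr, ENNReal.toReal_le_toReal (by finiteness) ((summable_iff_frameSum _ _).1 h)]

theorem isBessel_iff (W : WeightedSubspaces 𝕜 H ι) :
    W.IsBessel ↔ ∃ B : ℝ≥0, ∀ f, W.frameSum f ≤ B * ‖f‖ₑ ^ 2 := by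
  constructor
  · rintro ⟨B, h⟩
    refine ⟨B.toNNReal, fun f => (frameSum_le_iff _ _ _).2 ⟨(h f).1, (h f).2.trans ?_⟩⟩
    gcongr
    exact Real.le_coe_toNNReal B
  · rintro ⟨B, h⟩
    exact ⟨B, fun f => (frameSum_le_iff _ _ _).1 (h f)⟩

theorem isFusionFrame_iff (W : WeightedSubspaces 𝕜 H ι) :
    W.IsFusionFrame ↔ ∃ A B : ℝ≥0, 0 < A ∧ A ≤ B ∧ ∀ f,
      A * ‖f‖ₑ ^ 2 ≤ W.frameSum f ∧ W.frameSum f ≤ B * ‖f‖ₑ ^ 2 := by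
  constructor
  · rintro ⟨A, B, hA, hAB, h⟩
    lift A to ℝ≥0 using hA.le
    lift B to ℝ≥0 using A.2.trans hAB
    exact ⟨A, B, by exact_mod_cast hA, by exact_mod_cast hAB, fun f =>
      ⟨(le_frameSum_iff _ _ _ (h f).1).2 (h f).2.1,
        (frameSum_le_iff _ _ _).2 ⟨(h f).1, (h f).2.2⟩⟩⟩
  · rintro ⟨A, B, hA, hAB, h⟩
    refine ⟨A, B, by exact_mod_cast hA, by exact_mod_cast hAB, fun f => ?_⟩
    obtain ⟨h1, h2⟩ := (frameSum_le_iff _ _ _).1 (h f).2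
    exact ⟨h1, (le_frameSum_iff _ _ _ h1).1 (h f).1, h2⟩

/-! ### Frame bounds of the tensor product -/

theorem proj_tensor (W : WeightedSubspaces 𝕜 H ι) (V : WeightedSubspaces 𝕜 H κ) (p : ι × κ) :
    (W.tensor V).proj p = tensorOperator (W.proj p.1) (V.proj p.2) :=
  haveI : (tensorSubspace (W.space p.1) (V.space p.2)).HasOrthogonalProjection :=
    inferInstanceAs ((W.tensor V).space p).HasOrthogonalProjection
  starProjection_tensorSubspace _ _

theorem proj_tensor_apply (W : WeightedSubspaces 𝕜 H ι) (V : WeightedSubspaces 𝕜 H κ) (p : ι × κ)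
    (O : HilbertSchmidt 𝕜 H H) (x : H) :
    (W.tensor V).proj p O x = W.proj p.1 (O (V.proj p.2 x)) := by
  rw [proj_tensor]
  simp [(isSelfAdjoint_starProjection _).adjoint_eq]

/-- Tonelli, once each Hilbert-Schmidt norm is expanded over `b`: the sum over the index of `W` is
moved innermost, so that the frame inequality of `W` applies to single vectors. -/
theorem frameSum_tensor {β : Type*} (b : HilbertBasis β 𝕜 H) (W : WeightedSubspaces 𝕜 H ι)
    (V : WeightedSubspaces 𝕜 H κ) (O : HilbertSchmidt 𝕜 H H) :
    (W.tensor V).frameSum O =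
      ∑' i, ∑' k, W.frameSum ((V.weight i : 𝕜) • O (V.proj i (b k))) := by
  simp only [frameSum]
  rw [ENNReal.tsum_prod', ENNReal.tsum_comm]
  refine tsum_congr fun i => ?_
  rw [ENNReal.tsum_comm]
  refine tsum_congr fun j => ?_
  rw [HilbertSchmidt.enorm_sq_eq b]
  refine tsum_congr fun k => ?_
  have : (W.tensor V).weight (j, i) = W.weight j * V.weight i := rfl
  rw [this, map_smul, smul_apply, proj_tensor_apply, map_smul, smul_smul,
    RCLike.ofReal_mul]

/-- For fixed `i`, both sides contain the squared Hilbert-Schmidt norm of `v_i O π_{V_i}`, on the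
right computed from its adjoint `v_i π_{V_i} O*`. This moves `O` inside the projections of `V`. -/
theorem tsum_tsum_enorm_smul_apply_proj {β γ : Type*} (b : HilbertBasis β 𝕜 H)
    (c : HilbertBasis γ 𝕜 H) (V : WeightedSubspaces 𝕜 H κ) (O : H →L[𝕜] H) :
    ∑' i, ∑' k, ‖(V.weight i : 𝕜) • O (V.proj i (b k))‖ₑ ^ 2 =
      ∑' l, V.frameSum (O.adjoint (c l)) := by
  simp only [frameSum]
  -- Fixing `β := κ` selects the double sum on the right.
  rw [ENNReal.tsum_comm (β := κ)]
  refine tsum_congr fun i => ?_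
  have h := tsum_enorm_adjoint b c ((V.weight i : 𝕜) • (O ∘L V.proj i))
  rw [LinearIsometryEquiv.map_smulₛₗ, ContinuousLinearMap.adjoint_comp,
    (isSelfAdjoint_starProjection _).adjoint_eq, RCLike.conj_ofReal] at h
  exact h.symm

/-- The bound of `W` is used at the vectors `v_i O π_{V_i} b_k`, then that of `V` at `O* b_k`; the
squares `‖O* b_k‖²` add up to `‖O‖²`. -/
theorem frameSum_tensor_le {W : WeightedSubspaces 𝕜 H ι} {V : WeightedSubspaces 𝕜 H κ}
    {B C : ℝ≥0} (hW : ∀ f, W.frameSum f ≤ B * ‖f‖ₑ ^ 2) (hV : ∀ f, V.frameSum f ≤ C * ‖f‖ₑ ^ 2)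
    (O : HilbertSchmidt 𝕜 H H) :
    (W.tensor V).frameSum O ≤ (B * C : ℝ≥0) * ‖O‖ₑ ^ 2 := by
  obtain ⟨w, b, -⟩ := exists_hilbertBasis 𝕜 H
  rw [frameSum_tensor b]
  refine (ENNReal.tsum_le_tsum fun i => ENNReal.tsum_le_tsum fun k => hW _).trans ?_
  simp only [ENNReal.tsum_mul_left]
  rw [tsum_tsum_enorm_smul_apply_proj b b, ENNReal.coe_mul, mul_assoc,
    HilbertSchmidt.enorm_sq_eq b, ← tsum_enorm_adjoint b b]
  refine mul_le_mul_right ?_ _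
  rw [← ENNReal.tsum_mul_left]
  exact ENNReal.tsum_le_tsum fun k => hV _

theorem le_frameSum_tensor {W : WeightedSubspaces 𝕜 H ι} {V : WeightedSubspaces 𝕜 H κ}
    {B C : ℝ≥0} (hW : ∀ f, B * ‖f‖ₑ ^ 2 ≤ W.frameSum f) (hV : ∀ f, C * ‖f‖ₑ ^ 2 ≤ V.frameSum f)
    (O : HilbertSchmidt 𝕜 H H) :
    (B * C : ℝ≥0) * ‖O‖ₑ ^ 2 ≤ (W.tensor V).frameSum O := by
  obtain ⟨w, b, -⟩ := exists_hilbertBasis 𝕜 H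
  rw [frameSum_tensor b]
  refine le_trans ?_ (ENNReal.tsum_le_tsum fun i => ENNReal.tsum_le_tsum fun k => hW _)
  simp only [ENNReal.tsum_mul_left]
  rw [tsum_tsum_enorm_smul_apply_proj b b, ENNReal.coe_mul, mul_assoc,
    HilbertSchmidt.enorm_sq_eq b, ← tsum_enorm_adjoint b b]
  refine mul_le_mul_right ?_ _
  rw [← ENNReal.tsum_mul_left]
  exact ENNReal.tsum_le_tsum fun k => hV _

theorem IsBessel.tensor {W : WeightedSubspaces 𝕜 H ι} {V : WeightedSubspaces 𝕜 H κ}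
    (hW : W.IsBessel) (hV : V.IsBessel) : (W.tensor V).IsBessel := by
  rw [isBessel_iff] at *
  obtain ⟨B, hB⟩ := hW
  obtain ⟨C, hC⟩ := hV
  exact ⟨B * C, frameSum_tensor_le hB hC⟩

theorem IsFusionFrame.tensor {W : WeightedSubspaces 𝕜 H ι} {V : WeightedSubspaces 𝕜 H κ}
    (hW : W.IsFusionFrame) (hV : V.IsFusionFrame) : (W.tensor V).IsFusionFrame := by
  rw [isFusionFrame_iff] at *
  obtain ⟨A, B, hA, hAB, h⟩ := hW
  obtain ⟨A', B', hA', hAB', h'⟩ := hV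
  exact ⟨A * A', B * B', mul_pos hA hA', mul_le_mul' hAB hAB', fun O =>
    ⟨le_frameSum_tensor (fun f => (h f).1) (fun f => (h' f).1) O,
      frameSum_tensor_le (fun f => (h f).2) (fun f => (h' f).2) O⟩⟩

/-- If `∑ S j = S₀` and `∑ (T i)* = T₀*` strongly, then `(S₀ ⊗ T₀) O` is the only possible sum of
the family `(S j ⊗ T i) O`. -/
theorem tensorOperator_eq_of_hasSum {S : ι → H →L[𝕜] H} {T : κ → H →L[𝕜] H} {S₀ T₀ : H →L[𝕜] H}
    (hS : ∀ f, HasSum (fun j => S j f) (S₀ f))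
    (hT : ∀ f, HasSum (fun i => (T i).adjoint f) (T₀.adjoint f)) {O P : HilbertSchmidt 𝕜 H H}
    (h : HasSum (fun p : ι × κ => tensorOperator (S p.1) (T p.2) O) P) :
    tensorOperator S₀ T₀ O = P := by
  refine HilbertSchmidt.ext fun x => ?_
  refine HasSum.unique (hS _) ((h.mapL (HilbertSchmidt.eval 𝕜 H x)).prod_fiberwise fun j => ?_)
  exact (hT x).mapL (S j ∘L HilbertSchmidt.toCLM 𝕜 H H O)

/-! ### Frame operators, inverses and duals -/

theorem IsBessel.adjoint_frameOperator {W : WeightedSubspaces 𝕜 H ι} (hW : W.IsBessel) :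
    hW.frameOperator.adjoint = hW.frameOperator := by
  simp [IsBessel.frameOperator, IsBessel.synthesis, ContinuousLinearMap.adjoint_comp]

theorem IsFusionFrame.adjoint_invFrameOperator {W : WeightedSubspaces 𝕜 H ι}
    (hW : W.IsFusionFrame) : hW.invFrameOperator.adjoint = hW.invFrameOperator := by
  have hS := hW.isBessel.adjoint_frameOperator
  have hi := hW.isInvertible_frameOperator
  -- The adjoint of `S_W⁻¹` is a two-sided inverse of `S_W* = S_W`.
  have h1 := congrArg ContinuousLinearMap.adjoint hi.inverse_comp_self
  have h2 := congrArg ContinuousLinearMap.adjoint hi.self_comp_inverse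
  rw [ContinuousLinearMap.adjoint_comp, ContinuousLinearMap.adjoint_id, hS] at h1 h2
  exact (ContinuousLinearMap.inverse_eq h1 h2).symm

theorem frameOperator_tensor {W : WeightedSubspaces 𝕜 H ι} {V : WeightedSubspaces 𝕜 H κ}
    (hW : W.IsBessel) (hV : V.IsBessel) (hWV : (W.tensor V).IsBessel) :
    hWV.frameOperator = tensorOperator hW.frameOperator hV.frameOperator := by
  ext1 O
  refine (tensorOperator_eq_of_hasSum
    (S := fun j => ((W.weight j ^ 2 : ℝ) : 𝕜) • W.proj j)
    (T := fun i => ((V.weight i ^ 2 : ℝ) : 𝕜) • V.proj i)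
    hW.hasSum_frameOperator (fun f => ?_) ?_).symm
  · rw [hV.adjoint_frameOperator]
    simpa [LinearIsometryEquiv.map_smulₛₗ, (isSelfAdjoint_starProjection _).adjoint_eq]
      using hV.hasSum_frameOperator f
  · convert hWV.hasSum_frameOperator O using 2 with p
    rw [proj_tensor]
    refine HilbertSchmidt.ext fun x => ?_
    have : (W.tensor V).weight p = W.weight p.1 * V.weight p.2 := rfl
    simp [this, LinearIsometryEquiv.map_smulₛₗ, smul_smul, mul_pow, mul_comm]

/-- For Bessel fusion sequences `W` and `V` and a bounded operator `L`, the series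
`∑ i, w i v i π_{V i} L π_{W i} f` converges unconditionally. -/
theorem IsBessel.summable_smul_proj {W V : WeightedSubspaces 𝕜 H ι} (hW : W.IsBessel)
    (hV : V.IsBessel) (L : H →L[𝕜] H) (f : H) :
    Summable fun i => ((W.weight i * V.weight i : ℝ) : 𝕜) • V.proj i (L (W.proj i f)) := by
  -- The family `w_i π_{W_i} f` is in `ℓ²` and stays there under `L` and the projections, so the
  -- synthesis operator of `V` sums it.
  have hmem : Memℓp (fun i => (V.space i).orthogonalProjectionOnto
      (L ((W.weight i : 𝕜) • W.proj i f))) 2 := by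
    refine ((hW.memlp f).norm.const_smul ‖L‖).mono fun i => ?_
    refine ((V.space i).norm_orthogonalProjectionOnto_apply_le _).trans ?_
    exact L.le_opNorm _
  convert (hV.hasSum_synthesis ⟨_, hmem⟩).summable using 2 with i
  change _ = (V.weight i : 𝕜) • V.proj i (L ((W.weight i : 𝕜) • W.proj i f))
  rw [map_smul, map_smul, smul_smul, RCLike.ofReal_mul, mul_comm]

/-- Duality is symmetric: the series is the termwise adjoint of the reconstruction formula, `S_W⁻¹`
and the projections being self-adjoint. Taking adjoints preserves only weak convergence; strong
convergence comes from the two Bessel properties. -/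
theorem IsFusionFrame.IsDual.hasSum_adjoint {W W' : WeightedSubspaces 𝕜 H ι}
    {hW : W.IsFusionFrame} (h : hW.IsDual W') (f : H) :
    HasSum (fun i => ((W.weight i * W'.weight i : ℝ) : 𝕜) •
      W.proj i (hW.invFrameOperator (W'.proj i f))) f := by
  obtain ⟨s, hs⟩ := h.1.summable_smul_proj hW.isBessel hW.invFrameOperator f
  -- The sum exists, so testing against each `g` and conjugating the formula for `g` identifies it.
  have hsf : s = f := by
    refine ext_inner_left 𝕜 fun g => ?_
    refine (hs.mapL (innerSL 𝕜 g)).unique ?_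
    have h2 := ((h.2 g).mapL (innerSL 𝕜 f)).map (starRingEnd 𝕜) RCLike.continuous_conj
    simp only [innerSL_apply_apply, inner_conj_symm] at h2
    convert h2 using 2 with i
    simp only [Function.comp_apply, innerSL_apply_apply, inner_smul_right, map_mul,
      RCLike.conj_ofReal, inner_conj_symm]
    rw [Submodule.inner_starProjection_left_eq_right, ← hW.adjoint_invFrameOperator,
      ContinuousLinearMap.adjoint_inner_left, hW.adjoint_invFrameOperator,
      Submodule.inner_starProjection_left_eq_right, mul_comm (algebraMap ℝ 𝕜 (W'.weight i))]
  rw [hsf] at hs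
  simpa only [mul_comm] using hs

theorem IsFusionFrame.invFrameOperator_tensor {W : WeightedSubspaces 𝕜 H ι}
    {V : WeightedSubspaces 𝕜 H κ} (hW : W.IsFusionFrame) (hV : V.IsFusionFrame)
    (hWV : (W.tensor V).IsFusionFrame) :
    hWV.invFrameOperator = tensorOperator hW.invFrameOperator hV.invFrameOperator := by
  rw [invFrameOperator, frameOperator_tensor hW.isBessel hV.isBessel]
  exact (tensorOperator_inverse hW.isInvertible_frameOperator hV.isInvertible_frameOperator).2

theorem IsFusionFrame.canonicalDual_tensor {W : WeightedSubspaces 𝕜 H ι}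
    {V : WeightedSubspaces 𝕜 H κ} (hW : W.IsFusionFrame) (hV : V.IsFusionFrame)
    (hWV : (W.tensor V).IsFusionFrame) :
    hWV.canonicalDual = hW.canonicalDual.tensor hV.canonicalDual := by
  have h : hWV.canonicalDual.space = (hW.canonicalDual.tensor hV.canonicalDual).space := by
    funext p
    -- Here `e` and `g` are the inverses `S_W⁻¹` and `S_V⁻¹` themselves, as equivalences.
    obtain ⟨e, he⟩ := hW.isInvertible_frameOperator.inverse
    obtain ⟨g, hg⟩ := hV.isInvertible_frameOperator.inverse
    change (tensorSubspace (W.space p.1) (V.space p.2)).map hWV.invFrameOperator.toLinearMap =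
      tensorSubspace ((W.space p.1).map hW.invFrameOperator.toLinearMap)
        ((V.space p.2).map hV.invFrameOperator.toLinearMap)
    rw [invFrameOperator_tensor hW hV, invFrameOperator, invFrameOperator, ← he, ← hg]
    exact map_tensorSubspace e g _ _
  exact (mk.injEq ..).mpr ⟨h, rfl⟩

/-- Each term of the reconstruction series is the tensor product of a term for `W` and a term for
`V`. Both families sum strongly to the identity, and so do the adjoints for `V`, so the sum must be
`(1 ⊗ 1) O = O`. -/
theorem IsFusionFrame.IsDual.tensor {W W' : WeightedSubspaces 𝕜 H ι}
    {V V' : WeightedSubspaces 𝕜 H κ} {hW : W.IsFusionFrame} {hV : V.IsFusionFrame}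
    (h : hW.IsDual W') (h' : hV.IsDual V') (hWV : (W.tensor V).IsFusionFrame) :
    hWV.IsDual (W'.tensor V') := by
  have hB := h.1.tensor h'.1
  refine ⟨hB, fun O => ?_⟩
  obtain ⟨P, hP⟩ := hWV.isBessel.summable_smul_proj hB hWV.invFrameOperator O
  have hPO : tensorOperator (.id 𝕜 H) (.id 𝕜 H) O = P := by
    refine tensorOperator_eq_of_hasSum
      (S₀ := .id 𝕜 H) (T₀ := .id 𝕜 H)
      (S := fun j => ((W.weight j * W'.weight j : ℝ) : 𝕜) •
        (W'.proj j ∘L hW.invFrameOperator ∘L W.proj j))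
      (T := fun i => ((V.weight i * V'.weight i : ℝ) : 𝕜) •
        (V'.proj i ∘L hV.invFrameOperator ∘L V.proj i)) h.2 (fun f => ?_) ?_
    · simpa [LinearIsometryEquiv.map_smulₛₗ, (isSelfAdjoint_starProjection _).adjoint_eq,
        ContinuousLinearMap.adjoint_comp, ContinuousLinearMap.adjoint_id,
        hV.adjoint_invFrameOperator] using h'.hasSum_adjoint f
    · convert hP using 2 with p
      rw [proj_tensor, proj_tensor, hW.invFrameOperator_tensor hV]
      refine HilbertSchmidt.ext fun x => ?_
      have h1 : (W.tensor V).weight p = W.weight p.1 * V.weight p.2 := rfl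
      have h2 : (W'.tensor V').weight p = W'.weight p.1 * V'.weight p.2 := rfl
      simp only [h1, h2, tensorOperator_apply, map_smul, smul_apply,
        ContinuousLinearMap.comp_apply, LinearIsometryEquiv.map_smulₛₗ,
        ContinuousLinearMap.adjoint_comp, smul_smul, map_mul, RCLike.conj_ofReal]
      congr 1
      ring
  rw [tensorOperator_id] at hPO
  rwa [← hPO] at hP

end WeightedSubspaces

end FusionFrames

end

theorem mainTheorem12 {𝕜 H ι κ : Type*} [RCLike 𝕜]
    [NormedAddCommGroup H] [InnerProductSpace 𝕜 H] [CompleteSpace H]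
    (W : FusionFrames.WeightedSubspaces 𝕜 H ι) (V : FusionFrames.WeightedSubspaces 𝕜 H κ)
    (hW : W.IsFusionFrame) (hV : V.IsFusionFrame) :
    ∃ hWV : (W.tensor V).IsFusionFrame,
      hWV.isBessel.frameOperator =
        FusionFrames.tensorOperator hW.isBessel.frameOperator hV.isBessel.frameOperator ∧
      hWV.isBessel.frameOperator.IsInvertible ∧
      hWV.isBessel.frameOperator.inverse =
        FusionFrames.tensorOperator
          hW.isBessel.frameOperator.inverse hV.isBessel.frameOperator.inverse ∧
      hWV.canonicalDual = hW.canonicalDual.tensor hV.canonicalDual ∧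
      ∀ (W' : FusionFrames.WeightedSubspaces 𝕜 H ι) (V' : FusionFrames.WeightedSubspaces 𝕜 H κ),
        hW.IsDual W' → hV.IsDual V' → hWV.IsDual (W'.tensor V') := by
  exact ⟨hW.tensor hV,
    FusionFrames.WeightedSubspaces.frameOperator_tensor _ _ (hW.tensor hV).isBessel,
    (hW.tensor hV).isInvertible_frameOperator, hW.invFrameOperator_tensor hV (hW.tensor hV),
    hW.canonicalDual_tensor hV (hW.tensor hV), fun _ _ h h' => h.tensor h' (hW.tensor hV)⟩
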